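/- Let $n\ge 0$ and let $\mathcal H(n,\mathbb C)$ be the group, under composition, of all maps $z\mapsto \lambda z+b$ of $\mathbb C^n$ with $\lambda\in\mathbb C\setminus\{0\}$ and $b\in\mathbb C^n$. Let $\mathcal T_n$ be its subgroup of translations $z\mapsto z+b$, and let $\mathcal R_n$ be the set of the maps $z\mapsto e^{i\theta}z+b$ with $\theta\in\mathbb R$. Put $H_2=(\frac{\pi}{2}+\pi\mathbb Z)\cup\pi\mathbb Z$ and $H_3=(\frac{\pi}{3}+\pi\mathbb Z)\cup(-\frac{\pi}{3}+\pi\mathbb Z)\cup\pi\mathbb Z$. For $i\in\{2,3\}$ let $\mathcal S_i\mathcal R_n$ be the set of the maps $z\mapsto e^{i\theta}z+b$ with $\theta\in H_i$, $b\in\mathbb C^n$ (here the $i$ in $e^{i\theta}$ is the imaginary unit), and put $\mathcal{SR}_n=\mathcal S_2\mathcal R_n\cup\mathcal S_3\mathcal R_n$. Let $G$ be a non-abelian subgroup of $\mathcal H(n,\mathbb C)$ such that the set $\Lambda_G$ of all ratios $\lambda$ of elements $z\mapsto\lambda z+b$ of $G$ is not contained in $\mathbb R$. Write $G(v)=\{f(v):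 f\in G\}$ for the orbit of $v\in\mathbb C^n$; a set $A$ is $G$-invariant if $f(A)\subset A$ for all $f\in G$. Let $G_1=G\cap\mathcal T_n$ and $G_1(0)=\{f(0): f\in G_1\}$, let $\Gamma_G$ be the set of all fixed points of elements of $G\setminus\mathcal T_n$, let $E_G$ be the complex affine subspace of $\mathbb C^n$ generated by $\Gamma_G$, and let $U=\mathbb C^n\setminus E_G$. (1) Suppose that $G\not\subset\mathcal{SR}_n$ and $U\neq\emptyset$. Then: (i) $U$ is open and $G$-invariant, and every orbit in $U$ is minimal in $U$: for all $v\in U$ and all $w\in\overline{G(v)}\cap U$ one has $\overline{G(v)}\cap U=\overline{G(w)}\cap U$. (ii) If $G\not\subset\mathcal R_n$, then $E_G$ is a minimal set of $G$ in $\mathbb C^n$ (it is non-empty, closed and $G$-invariant, and it has no other non-empty closed $G$-invariant subset than itself), and $E_G\subset\overline{G(v)}$ for every $v\in\mathbb C^n$. (iii) All orbits in $U$ are homeomorphic to each other (with the subspace topology). (2) If $G\subset\mathcal{SR}_n$, then $G$ has a dense orbit in $\mathbb C^n$ if and only if $\overline{G_1(0)}=\mathbb C^n$. -/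

import Mathlib

namespace AffineHomothety

/-- The space `ℂⁿ` with its usual topology. -/
abbrev Cn (n : ℕ) : Type := EuclideanSpace ℂ (Fin n)

/-- `HasForm f c b` says that `f` is the map `z ↦ c z + b` of `ℂⁿ`. -/
def HasForm {n : ℕ} (f : Equiv.Perm (Cn n)) (c : ℂ) (b : Cn n) : Prop :=
  ∀ z : Cn n, f z = c • z + b

theorem HasForm.one {n : ℕ} : HasForm (1 : Equiv.Perm (Cn n)) 1 0 := by
  intro z; simp

theorem HasForm.mul {n : ℕ} {f g : Equiv.Perm (Cn n)} {c d : ℂ} {a b : Cn n}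
    (hf : HasForm f c a) (hg : HasForm g d b) : HasForm (f * g) (c * d) (c • b + a) := by
  intro z
  rw [Equiv.Perm.mul_apply, hg z, hf, smul_add, mul_smul, add_assoc]

theorem HasForm.inv {n : ℕ} {f : Equiv.Perm (Cn n)} {c : ℂ} {a : Cn n}
    (hf : HasForm f c a) (hc : c ≠ 0) : HasForm f⁻¹ c⁻¹ (-(c⁻¹ • a)) := by
  intro z
  rw [Equiv.Perm.inv_eq_iff_eq, hf, smul_add, smul_inv_smul₀ hc, smul_neg, smul_inv_smul₀ hc,
    neg_add_cancel_right]

/-- The group `ℋ(n, ℂ)` of all maps `z ↦ c z + b` of `ℂⁿ` with `c ≠ 0`. -/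
def homotheties (n : ℕ) : Subgroup (Equiv.Perm (Cn n)) where
  carrier := {f | ∃ (c : ℂ) (b : Cn n), c ≠ 0 ∧ HasForm f c b}
  one_mem' := ⟨1, 0, one_ne_zero, HasForm.one⟩
  mul_mem' := by
    rintro f g ⟨c, a, hc, hf⟩ ⟨d, b, hd, hg⟩
    exact ⟨c * d, c • b + a, mul_ne_zero hc hd, hf.mul hg⟩
  inv_mem' := by
    rintro f ⟨c, a, hc, hf⟩
    exact ⟨c⁻¹, _, inv_ne_zero hc, hf.inv hc⟩

/-- The group `𝒯ₙ` of all translations `z ↦ z + b` of `ℂⁿ`. -/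
def translations (n : ℕ) : Subgroup (Equiv.Perm (Cn n)) where
  carrier := {f | ∃ b : Cn n, HasForm f 1 b}
  one_mem' := ⟨0, HasForm.one⟩
  mul_mem' := by
    rintro f g ⟨a, hf⟩ ⟨b, hg⟩
    have h := hf.mul hg
    rw [one_mul] at h
    exact ⟨_, h⟩
  inv_mem' := by
    rintro f ⟨a, hf⟩
    have h := hf.inv one_ne_zero
    rw [inv_one] at h
    exact ⟨_, h⟩

/-- `ℛₙ`: the maps `z ↦ e^{iθ} z + a` with `θ` real. -/
def rotations (n : ℕ) : Set (Equiv.Perm (Cn n)) :=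
  {f | ∃ (θ : ℝ) (a : Cn n), HasForm f (Complex.exp (θ * Complex.I)) a}

/-- `H₂ = (π/2 + πℤ) ∪ πℤ`. -/
def angles₂ : Set ℝ :=
  {θ | ∃ k : ℤ, θ = Real.pi / 2 + Real.pi * k} ∪ {θ | ∃ k : ℤ, θ = Real.pi * k}

/-- `H₃ = (π/3 + πℤ) ∪ (-π/3 + πℤ) ∪ πℤ`. -/
def angles₃ : Set ℝ :=
  {θ | ∃ k : ℤ, θ = Real.pi / 3 + Real.pi * k} ∪
    {θ | ∃ k : ℤ, θ = -(Real.pi / 3) + Real.pi * k} ∪ {θ | ∃ k : ℤ, θ = Real.pi * k}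

/-- The rotations `z ↦ e^{iθ} z + a` whose angle `θ` lies in `H`. -/
def rotationsWithAngle (n : ℕ) (H : Set ℝ) : Set (Equiv.Perm (Cn n)) :=
  {f | ∃ (θ : ℝ) (a : Cn n), θ ∈ H ∧ HasForm f (Complex.exp (θ * Complex.I)) a}

/-- `𝒮ℛₙ = 𝒮₂ℛₙ ∪ 𝒮₃ℛₙ`. -/
def specialRotations (n : ℕ) : Set (Equiv.Perm (Cn n)) :=
  rotationsWithAngle n angles₂ ∪ rotationsWithAngle n angles₃

/-- `Λ_G`: the set of ratios `c` of the elements `z ↦ c z + b` of `G`. -/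
def ratios {n : ℕ} (G : Subgroup (Equiv.Perm (Cn n))) : Set ℂ :=
  {c | ∃ f ∈ G, ∃ b : Cn n, HasForm f c b}

/-- `Γ_G`: the set of fixed points (centers) of the elements of `G` that are not translations. -/
def centers {n : ℕ} (G : Subgroup (Equiv.Perm (Cn n))) : Set (Cn n) :=
  ⋃ f ∈ (G : Set (Equiv.Perm (Cn n))) \ translations n, Function.fixedPoints f

/-- `G₁ = G ∩ 𝒯ₙ`. -/
def translationPart {n : ℕ} (G : Subgroup (Equiv.Perm (Cn n))) : Subgroup (Equiv.Perm (Cn n)) :=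
  G ⊓ translations n

/-- `E_G`: the complex affine subspace of `ℂⁿ` generated by `Γ_G`. -/
noncomputable def centerSpan {n : ℕ} (G : Subgroup (Equiv.Perm (Cn n))) : AffineSubspace ℂ (Cn n) :=
  affineSpan ℂ (centers G)

/-- `U = ℂⁿ ∖ E_G`. -/
def outside {n : ℕ} (G : Subgroup (Equiv.Perm (Cn n))) : Set (Cn n) :=
  (centerSpan G : Set (Cn n))ᶜ

/-- The orbit `G(v) = {f v : f ∈ G}`. -/
abbrev orb {n : ℕ} (G : Subgroup (Equiv.Perm (Cn n))) (v : Cn n) : Set (Cn n) :=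
  MulAction.orbit G v

/-- `A` is `G`-invariant: `f(A) ⊆ A` for every `f ∈ G`. -/
def Invariant {n : ℕ} (G : Subgroup (Equiv.Perm (Cn n))) (A : Set (Cn n)) : Prop :=
  ∀ f ∈ G, f '' A ⊆ A

/-- `U` is an open `G`-invariant set and the orbit `G(v)`, contained in `U`, is minimal in `U`. -/
def IsMinimalOrbitIn {n : ℕ} (G : Subgroup (Equiv.Perm (Cn n))) (U : Set (Cn n)) (v : Cn n) :
    Prop :=
  IsOpen U ∧ Invariant G U ∧ orb G v ⊆ U ∧
    ∀ w ∈ closure (orb G v) ∩ U, closure (orb G v) ∩ U = closure (orb G w) ∩ U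

/-- `M` is a minimal set of `G` in `ℂⁿ`: a nonempty closed `G`-invariant set which is the only
nonempty closed `G`-invariant subset of itself. -/
def IsMinimalSet {n : ℕ} (G : Subgroup (Equiv.Perm (Cn n))) (M : Set (Cn n)) : Prop :=
  M.Nonempty ∧ IsClosed M ∧ Invariant G M ∧
    ∀ A : Set (Cn n), A.Nonempty → IsClosed A → Invariant G A → A ⊆ M → A = M

end AffineHomothety

open AffineHomothety

/-!
The argument compares `G` with its translations. Let `T` be the additive group of the vectors of
the translations in `G`; conjugation shows that it is stable under multiplication by the ratios
of `G`, so the scalars preserving `closure T` form a closed subring `R` of `ℂ` containing all the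
ratios.

A closed subring `R` of `ℂ` that contains a non-real `α` is all of `ℂ`, unless every unit of `R` is
a fourth or sixth root of unity (`subring_eq_top`). If `R` has arbitrarily small elements `r ≠ 0`,
then the lattices `r (ℤ + ℤ α) ⊆ R` are arbitrarily fine and `R` is dense. Otherwise every non-zero
element of `R` has norm at least `1`; a unit `e^{iθ}` then has norm `1`, and the real element
`2 cos θ` of `R`, being at distance less than `1` from an integer, is an integer.

So if `G` has an element that is not a special rotation, `H = closure T` is a complex subspace.
Let `p` be the center of an element `f₀` of non-real ratio. Comparing `f₀` with its conjugates by
`f ∈ G` gives `f p - p ∈ H`, hence `f z = p + c (z - p) + h` with `h ∈ H`, and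
`E_G = p + H` (`exists_normalForm`). Closed invariant sets are stable under adding vectors of `H`.
Modulo `H` the group thus acts by homotheties with the single center `p`, where minimality of the
orbits (`mem_closure_orb_symm`) and attraction to `p` by a contraction (`centerSpan_subset`) are
visible. Affine maps that fix `p + H` pointwise commute with `G` and act transitively on the
complement, which makes the orbits there homeomorphic (`exists_homeomorph`).

If `G` consists of special rotations, its ratios are twelfth roots of unity, so every orbit lies in
finitely many translates of `closure T`. If the orbit is dense then `closure T` has finite index in
the divisible group `ℂⁿ`, and so is everything.
-/

namespace AffineHomothety

open Filter Topology

/-! ### Closed subrings of the complex numbers -/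

/-- For small `r ∈ R`, the lattice `r (ℤ + ℤ α) ⊆ R` comes within `‖r‖ (1 + ‖α‖)` of every
point. -/
theorem subring_eq_top_of_small {R : Subring ℂ} (hR : IsClosed (R : Set ℂ)) {α : ℂ} (hα : α ∈ R)
    (him : α.im ≠ 0) (hsmall : ∀ ε > 0, ∃ r ∈ R, r ≠ 0 ∧ ‖r‖ < ε) : R = ⊤ := by
  rw [eq_top_iff]
  intro z _
  refine hR.closure_subset (Metric.mem_closure_iff.2 fun ε hε => ?_)
  have hC : 0 < 1 + ‖α‖ := by positivity
  obtain ⟨r, hrR, hr0, hr⟩ := hsmall (ε / (1 + ‖α‖)) (by positivity)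
  set q : ℂ := z / r with hq
  set b : ℝ := q.im / α.im with hb
  set a : ℝ := q.re - b * α.re with ha
  have hqab : q = a + b * α := by
    apply Complex.ext
    · simp [ha]
    · simp [hb, him]
  refine ⟨r * (round a + round b * α), R.mul_mem hrR
    (R.add_mem (intCast_mem R _) (R.mul_mem (intCast_mem R _) hα)), ?_⟩
  have hz : z = r * q := by rw [hq]; field_simp
  have h1 : z - r * (round a + round b * α)
      = r * (((a - round a : ℝ) : ℂ) + ((b - round b : ℝ) : ℂ) * α) := by
    rw [hz, hqab]; push_cast; ring
  rw [dist_eq_norm, h1, norm_mul]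
  have h2 : ‖((a - round a : ℝ) : ℂ) + ((b - round b : ℝ) : ℂ) * α‖ ≤ 1 + ‖α‖ := by
    refine (norm_add_le _ _).trans ?_
    rw [norm_mul, Complex.norm_real, Complex.norm_real, Real.norm_eq_abs, Real.norm_eq_abs]
    have ha' := abs_sub_round a
    have hb' := abs_sub_round b
    have := norm_nonneg α
    nlinarith
  calc ‖r‖ * _ ≤ ‖r‖ * (1 + ‖α‖) := by gcongr
    _ < ε := by rwa [lt_div_iff₀ hC] at hr

/-- An element of norm less than `1` would have arbitrarily small powers. -/
theorem one_le_norm_of_not_small {R : Subring ℂ} {ε : ℝ} (hε : 0 < ε)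
    (h : ∀ r ∈ R, r ≠ 0 → ε ≤ ‖r‖) {r : ℂ} (hr : r ∈ R) (hr0 : r ≠ 0) : 1 ≤ ‖r‖ := by
  by_contra! hlt
  obtain ⟨k, hk⟩ := exists_pow_lt_of_lt_one hε hlt
  have := h (r ^ k) (R.pow_mem hr k) (pow_ne_zero k hr0)
  rw [norm_pow] at this
  linarith

/-- The integer `m` is one of `-2, …, 2`; each value gives one of the angles of `H₂ ∪ H₃`. -/
theorem mem_angles_of_two_mul_cos {θ : ℝ} {m : ℤ} (h : 2 * Real.cos θ = m) :
    θ ∈ angles₂ ∪ angles₃ := by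
  have h1 : (m : ℝ) ≤ 2 := by have := Real.cos_le_one θ; linarith
  have h2 : (-2 : ℝ) ≤ m := by have := Real.neg_one_le_cos θ; linarith
  have h1' : m ≤ 2 := by exact_mod_cast h1
  have h2' : -2 ≤ m := by exact_mod_cast h2
  interval_cases m
  · have : Real.cos θ = Real.cos Real.pi := by rw [Real.cos_pi]; push_cast at h; linarith
    obtain ⟨k, hk | hk⟩ := Real.cos_eq_cos_iff.1 this
    · exact .inl (.inr ⟨1 - 2 * k, by push_cast; linarith⟩)
    · exact .inl (.inr ⟨2 * k - 1, by push_cast; linarith⟩)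
  · have : Real.cos θ = Real.cos (Real.pi - Real.pi / 3) := by
      rw [Real.cos_pi_sub, Real.cos_pi_div_three]; push_cast at h; linarith
    obtain ⟨k, hk | hk⟩ := Real.cos_eq_cos_iff.1 this
    · exact .inr (.inl (.inr ⟨1 - 2 * k, by push_cast; linarith⟩))
    · exact .inr (.inl (.inl ⟨2 * k - 1, by push_cast; linarith⟩))
  · have : Real.cos θ = 0 := by push_cast at h; linarith
    obtain ⟨k, hk⟩ := Real.cos_eq_zero_iff.1 this
    exact .inl (.inl ⟨k, by linarith⟩)
  · have : Real.cos θ = Real.cos (Real.pi / 3) := by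
      rw [Real.cos_pi_div_three]; push_cast at h; linarith
    obtain ⟨k, hk | hk⟩ := Real.cos_eq_cos_iff.1 this
    · exact .inr (.inl (.inl ⟨-2 * k, by push_cast; linarith⟩))
    · exact .inr (.inl (.inr ⟨2 * k, by push_cast; linarith⟩))
  · have : Real.cos θ = Real.cos 0 := by rw [Real.cos_zero]; push_cast at h; linarith
    obtain ⟨k, hk | hk⟩ := Real.cos_eq_cos_iff.1 this
    · exact .inl (.inr ⟨-2 * k, by push_cast; linarith⟩)
    · exact .inl (.inr ⟨2 * k, by push_cast; linarith⟩)

theorem exists_angle_of_discrete {R : Subring ℂ} {β : ℂ} (hβ : β ∈ R) (hβi : β⁻¹ ∈ R) (hβ0 : β ≠ 0)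
    (h : ∀ r ∈ R, r ≠ 0 → 1 ≤ ‖r‖) :
    ∃ θ ∈ angles₂ ∪ angles₃, β = Complex.exp (θ * Complex.I) := by
  have hn : ‖β‖ = 1 := by
    refine le_antisymm ?_ (h β hβ hβ0)
    have := h _ hβi (inv_ne_zero hβ0)
    rw [norm_inv] at this
    exact (one_le_inv₀ (norm_pos_iff.2 hβ0)).1 this
  have hexp : β = Complex.exp (β.arg * Complex.I) := by
    have := Complex.norm_mul_exp_arg_mul_I β
    rw [hn, Complex.ofReal_one, one_mul] at this
    exact this.symm
  refine ⟨β.arg, ?_, hexp⟩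
  -- `t = β + β⁻¹` is a real element of `R`, and so is its distance to the nearest integer.
  set t : ℝ := 2 * Real.cos β.arg with ht
  have htR : (t : ℂ) ∈ R := by
    have : (t : ℂ) = β + β⁻¹ := by
      rw [ht]; push_cast
      rw [Complex.two_cos, neg_mul, Complex.exp_neg, ← hexp]
    rw [this]
    exact R.add_mem hβ hβi
  refine mem_angles_of_two_mul_cos (m := round t) ?_
  by_contra hne
  have h1 := h ((t : ℂ) - round t) (R.sub_mem htR (intCast_mem R _)) (by
    intro h0
    exact hne (by exact_mod_cast sub_eq_zero.1 h0))
  have h2 : (t : ℂ) - round t = ((t - round t : ℝ) : ℂ) := by push_cast; rfl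
  rw [h2, Complex.norm_real, Real.norm_eq_abs] at h1
  linarith [abs_sub_round t]

theorem subring_eq_top {R : Subring ℂ} (hR : IsClosed (R : Set ℂ)) {α β : ℂ} (hα : α ∈ R)
    (him : α.im ≠ 0) (hβ : β ∈ R) (hβi : β⁻¹ ∈ R) (hβ0 : β ≠ 0)
    (hang : ∀ θ ∈ angles₂ ∪ angles₃, β ≠ Complex.exp (θ * Complex.I)) : R = ⊤ := by
  by_contra hne
  have : ∃ ε > 0, ∀ r ∈ R, r ≠ 0 → ε ≤ ‖r‖ := by
    by_contra! hs
    exact hne (subring_eq_top_of_small hR hα him hs)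
  obtain ⟨ε, hε, h⟩ := this
  obtain ⟨θ, hθ, h⟩ := exists_angle_of_discrete hβ hβi hβ0
    fun r hr hr0 => one_le_norm_of_not_small hε h hr hr0
  exact hang θ hθ h

/-! ### Stabilizing scalars of an additive subgroup -/

/-- The ring of the complex numbers `z` with `z H ⊆ H`. -/
def scalarStabilizer {E : Type*} [AddCommGroup E] [Module ℂ E] (H : AddSubgroup E) :
    Subring ℂ where
  carrier := {z | ∀ h ∈ H, z • h ∈ H}
  one_mem' h hh := by rwa [one_smul]
  zero_mem' h _ := by rw [zero_smul]; exact H.zero_mem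
  mul_mem' {a b} ha hb h hh := by rw [mul_smul]; exact ha _ (hb _ hh)
  add_mem' {a b} ha hb h hh := by rw [add_smul]; exact H.add_mem (ha _ hh) (hb _ hh)
  neg_mem' {a} ha h hh := by rw [neg_smul]; exact H.neg_mem (ha _ hh)

theorem isClosed_scalarStabilizer {E : Type*} [NormedAddCommGroup E] [NormedSpace ℂ E]
    {H : AddSubgroup E} (hH : IsClosed (H : Set E)) : IsClosed (scalarStabilizer H : Set ℂ) := by
  have : (scalarStabilizer H : Set ℂ) = ⋂ h ∈ H, (fun z : ℂ => z • h) ⁻¹' (H : Set E) := by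
    ext z; simp [scalarStabilizer]
  rw [this]
  exact isClosed_biInter fun h _ => hH.preimage (by fun_prop)

theorem smul_mem_topologicalClosure {E : Type*} [NormedAddCommGroup E] [NormedSpace ℂ E]
    {T : AddSubgroup E} {c : ℂ} (h : ∀ t ∈ T, c • t ∈ T) :
    c ∈ scalarStabilizer T.topologicalClosure := fun _ ht =>
  map_mem_closure (f := fun x : E => c • x) (by fun_prop) ht h

/-! ### Groups of homotheties and their translations -/

section Group

variable {n : ℕ} {G : Subgroup (Equiv.Perm (Cn n))}

theorem HasForm.apply_eq {f : Equiv.Perm (Cn n)} {c : ℂ} {b : Cn n} (hf : HasForm f c b)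
    (x z : Cn n) : f z = c • (z - x) + f x := by
  rw [hf z, hf x, smul_sub]; abel

theorem HasForm.continuous {f : Equiv.Perm (Cn n)} {c : ℂ} {b : Cn n} (hf : HasForm f c b) :
    Continuous f := by
  rw [show (f : Cn n → Cn n) = fun z => c • z + b from funext hf]
  fun_prop

theorem HasForm.notMem_translations [Nontrivial (Cn n)] {f : Equiv.Perm (Cn n)} {c : ℂ} {b : Cn n}
    (hf : HasForm f c b) (hc : c ≠ 1) : f ∉ translations n := by
  rintro ⟨b', hb'⟩
  obtain ⟨z, hz⟩ := exists_ne (0 : Cn n)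
  have h0 : b = b' := by have := (hf 0).symm.trans (hb' 0); simpa using this
  have h1 := (hf z).symm.trans (hb' z)
  rw [h0, one_smul, add_left_inj] at h1
  have h2 : (c - 1) • z = 0 := by rw [sub_smul, one_smul, h1, sub_self]
  exact (smul_ne_zero (sub_ne_zero.2 hc) hz) h2

/-- The vectors `b` such that the translation `z ↦ z + b` belongs to `G`. -/
def translationVectors (G : Subgroup (Equiv.Perm (Cn n))) : AddSubgroup (Cn n) where
  carrier := {b | ∃ f ∈ G, HasForm f 1 b}
  zero_mem' := ⟨1, G.one_mem, HasForm.one⟩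
  add_mem' := by
    rintro a b ⟨f, hf, hfa⟩ ⟨g, hg, hgb⟩
    have h := hgb.mul hfa
    rw [one_mul, one_smul] at h
    exact ⟨_, G.mul_mem hg hf, h⟩
  neg_mem' := by
    rintro a ⟨f, hf, hfa⟩
    have h := hfa.inv one_ne_zero
    rw [inv_one, one_smul] at h
    exact ⟨_, G.inv_mem hf, h⟩

theorem orb_translationPart_zero :
    orb (translationPart G) 0 = (translationVectors G : Set (Cn n)) := by
  ext x
  constructor
  · rintro ⟨⟨f, hf, b, hb⟩, rfl⟩
    refine ⟨f, hf, ?_⟩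
    have : f 0 = b := by simpa using hb 0
    change HasForm f 1 (f 0)
    rwa [this]
  · rintro ⟨f, hf, hfx⟩
    exact ⟨⟨f, hf, x, hfx⟩, by change f 0 = x; simpa using hfx 0⟩

theorem apply_mem_orb {f : Equiv.Perm (Cn n)} (hf : f ∈ G) (v : Cn n) : f v ∈ orb G v :=
  ⟨⟨f, hf⟩, rfl⟩

theorem smul_mem_translationVectors {f : Equiv.Perm (Cn n)} (hf : f ∈ G) {c : ℂ} {b t : Cn n}
    (hc : c ≠ 0) (hfc : HasForm f c b) (ht : t ∈ translationVectors G) :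
    c • t ∈ translationVectors G := by
  obtain ⟨g, hg, hgt⟩ := ht
  refine ⟨f * g * f⁻¹, G.mul_mem (G.mul_mem hf hg) (G.inv_mem hf), ?_⟩
  have := (hfc.mul hgt).mul (hfc.inv hc)
  convert this using 1
  · field_simp
  · rw [mul_one, smul_neg, smul_inv_smul₀ hc]; abel

/-- Two elements of `G` with the same ratio differ by a translation. -/
theorem sub_mem_translationVectors {f g : Equiv.Perm (Cn n)} (hf : f ∈ G) (hg : g ∈ G) {c : ℂ}
    {a b : Cn n} (hc : c ≠ 0) (hfc : HasForm f c a) (hgc : HasForm g c b) (v : Cn n) :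
    f v - g v ∈ translationVectors G := by
  refine ⟨f * g⁻¹, G.mul_mem hf (G.inv_mem hg), ?_⟩
  have := hfc.mul (hgc.inv hc)
  convert this using 1
  · field_simp
  · rw [hfc v, hgc v, smul_neg, smul_inv_smul₀ hc]; abel

theorem Invariant.closure_orb (hG : G ≤ homotheties n) (v : Cn n) :
    Invariant G (closure (orb G v)) := by
  rintro f hf _ ⟨x, hx, rfl⟩
  obtain ⟨c, b, -, hfc⟩ := hG hf
  refine map_mem_closure hfc.continuous hx ?_
  rintro _ ⟨g, rfl⟩
  exact apply_mem_orb (G.mul_mem hf g.2) v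

theorem closure_orb_subset {A : Set (Cn n)} (hA : IsClosed A) (hinv : Invariant G A) {w : Cn n}
    (hw : w ∈ A) : closure (orb G w) ⊆ A := by
  refine hA.closure_subset_iff.2 ?_
  rintro _ ⟨g, rfl⟩
  exact hinv g g.2 ⟨w, hw, rfl⟩

/-- A non-abelian group excludes `n = 0`, where ratios are not determined by the maps. -/
theorem nontrivial_of_not_comm (hnonab : ∃ f ∈ G, ∃ g ∈ G, f * g ≠ g * f) :
    Nontrivial (Cn n) := by
  by_contra h
  rw [not_nontrivial_iff_subsingleton] at h
  obtain ⟨f, -, g, -, hfg⟩ := hnonab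
  exact hfg (Subsingleton.elim _ _)

/-! ### The normal form of a group that is not special -/

/-- `G` acts on `ℂⁿ` by maps `z ↦ c (z - p) + p + h` with `h` in the complex subspace `H`, and the
translations in `G` are dense in those by vectors of `H`; moreover `E_G = p + H`. -/
structure NormalForm (G : Subgroup (Equiv.Perm (Cn n))) (p : Cn n) (H : Submodule ℂ (Cn n)) :
    Prop where
  homotheties : G ≤ homotheties n
  closure_eq : closure (translationVectors G : Set (Cn n)) = H
  apply_sub_mem : ∀ f ∈ G, f p - p ∈ H
  mem_centerSpan : ∀ x, x ∈ centerSpan G ↔ x - p ∈ H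

/-- `H` is the closure of the translation vectors, a complex subspace by `subring_eq_top`, and `p` is
the center of an element of non-real ratio. -/
theorem exists_normalForm [Nontrivial (Cn n)] (hG : G ≤ homotheties n)
    (hratio : (ratios G \ Set.range ((↑) : ℝ → ℂ)).Nonempty)
    (hspecial : ((G : Set (Equiv.Perm (Cn n))) \ specialRotations n).Nonempty) :
    ∃ p H, NormalForm G p H := by
  obtain ⟨α, ⟨f₀, hf₀, b₀, hfb₀⟩, hα⟩ := hratio
  obtain ⟨g, hg, hgs⟩ := hspecial
  obtain ⟨β, b, hβ0, hgb⟩ := hG hg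
  have him : α.im ≠ 0 := fun h => hα ⟨α.re, Complex.ext (by simp) (by simp [h])⟩
  have hα0 : α ≠ 0 := by rintro rfl; simp at him
  have hα1 : α ≠ 1 := by rintro rfl; simp at him
  have hα1' : 1 - α ≠ 0 := sub_ne_zero.2 hα1.symm
  set T := translationVectors G
  have hst {c : ℂ} {f : Equiv.Perm (Cn n)} {b : Cn n} (hf : f ∈ G) (hc : c ≠ 0)
      (hfc : HasForm f c b) : c ∈ scalarStabilizer T.topologicalClosure :=
    smul_mem_topologicalClosure fun t ht => smul_mem_translationVectors hf hc hfc ht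
  have htop : scalarStabilizer T.topologicalClosure = ⊤ := by
    refine subring_eq_top (isClosed_scalarStabilizer T.isClosed_topologicalClosure)
      (hst hf₀ hα0 hfb₀) him (hst hg hβ0 hgb)
      (hst (G.inv_mem hg) (inv_ne_zero hβ0) (hgb.inv hβ0)) hβ0 ?_
    rintro θ (hθ | hθ) rfl
    · exact hgs (.inl ⟨θ, b, hθ, hgb⟩)
    · exact hgs (.inr ⟨θ, b, hθ, hgb⟩)
  let H : Submodule ℂ (Cn n) :=
    { T.topologicalClosure with
      smul_mem' := fun c x hx => (htop ▸ Subring.mem_top c : c ∈ scalarStabilizer _) x hx }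
  have hTH {t : Cn n} (ht : t ∈ T) : t ∈ H := subset_closure ht
  set p : Cn n := (1 - α)⁻¹ • b₀ with hp
  have hfp : f₀ p = p := by
    have : (1 - α) • p = b₀ := smul_inv_smul₀ hα1' _
    rw [hfb₀ p, ← this, ← add_smul]; simp
  have happ (f) (hf : f ∈ G) : f p - p ∈ H := by
    obtain ⟨c, a, hc, hfc⟩ := hG hf
    -- `f f₀ f⁻¹` has the ratio `α` of `f₀` and fixes `f p`.
    have hconj := (hfc.mul hfb₀).mul (hfc.inv hc)
    rw [show c * α * c⁻¹ = α by field_simp] at hconj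
    have hfix : (f * f₀ * f⁻¹) (f p) = f p := by simp [Equiv.Perm.mul_apply, hfp]
    have h := sub_mem_translationVectors
      (G.mul_mem (G.mul_mem hf hf₀) (G.inv_mem hf)) hf₀ hα0 hconj hfb₀ p
    rw [hconj.apply_eq (f p) p, hfix, hfp] at h
    have h' := H.smul_mem (1 - α)⁻¹ (hTH h)
    convert h' using 1
    rw [eq_inv_smul_iff₀ hα1']
    module
  have hcenter {f : Equiv.Perm (Cn n)} (hf : f ∈ G) {b x : Cn n} (hfb : HasForm f α b)
      (hx : f x = x) : x ∈ centers G :=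
    Set.mem_biUnion (show f ∈ (G : Set _) \ translations n from
      ⟨hf, hfb.notMem_translations hα1⟩) hx
  have hpE : p ∈ centerSpan G := subset_affineSpan ℂ _ (hcenter hf₀ hfb₀ hfp)
  refine ⟨p, H, hG, rfl, happ, fun x => ⟨fun hx => ?_, fun hx => ?_⟩⟩
  · have hle : centerSpan G ≤ AffineSubspace.mk' p H := by
      refine affineSpan_le.2 fun y hy => ?_
      simp only [centers, Set.mem_iUnion] at hy
      obtain ⟨f, ⟨hf, hft⟩, hy⟩ := hy
      obtain ⟨c, a, hc, hfc⟩ := hG hf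
      have hc1 : 1 - c ≠ 0 := by
        intro h
        rw [sub_eq_zero] at h
        exact hft ⟨a, h ▸ hfc⟩
      have hy' : f y = y := hy
      have h := H.smul_mem (1 - c)⁻¹ (happ f hf)
      change y ∈ AffineSubspace.mk' p H
      rw [AffineSubspace.mem_mk', vsub_eq_sub]
      convert h using 1
      rw [eq_inv_smul_iff₀ hc1]
      have := hfc.apply_eq p y
      rw [hy'] at this
      have h2 : f p = y - c • (y - p) := by rw [eq_sub_iff_add_eq, add_comm, ← this]
      rw [h2]
      module
    have := hle hx
    rwa [AffineSubspace.mem_mk', vsub_eq_sub] at this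
  -- Conjugating `f₀` by the translation by `t` moves its center from `p` to `p + t`.
  · have hdir : (translationVectors G : Set (Cn n)) ⊆ (centerSpan G).direction := by
      rintro t ⟨g, hg, hgt⟩
      have hconj := (hgt.mul hfb₀).mul (hgt.inv one_ne_zero)
      rw [show 1 * α * 1⁻¹ = α by simp] at hconj
      have hgp : g p = p + t := by simpa using hgt p
      have hfix : (g * f₀ * g⁻¹) (g p) = g p := by simp [Equiv.Perm.mul_apply, hfp]
      have hmem : g p ∈ centerSpan G := subset_affineSpan ℂ _
        (hcenter (G.mul_mem (G.mul_mem hg hf₀) (G.inv_mem hg)) hconj hfix)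
      have := AffineSubspace.vsub_mem_direction hmem hpE
      simpa [hgp] using this
    have hx' : x - p ∈ (centerSpan G).direction :=
      closure_minimal hdir (Submodule.closed_of_finiteDimensional _) hx
    have := AffineSubspace.vadd_mem_of_mem_direction hx' hpE
    simpa using this

theorem isOpen_outside : IsOpen (outside G) :=
  (AffineSubspace.closed_of_finiteDimensional (centerSpan G)).isOpen_compl

namespace NormalForm

variable {p : Cn n} {H : Submodule ℂ (Cn n)} (N : NormalForm G p H)
include N

theorem exists_ratio {f : Equiv.Perm (Cn n)} (hf : f ∈ G) :
    ∃ c : ℂ, c ≠ 0 ∧ (∃ b, HasForm f c b) ∧ ∀ z, f z = p + c • (z - p) + (f p - p) := by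
  obtain ⟨c, b, hc, hfc⟩ := N.homotheties hf
  refine ⟨c, hc, ⟨b, hfc⟩, fun z => ?_⟩
  rw [hfc.apply_eq p z]; abel

theorem invariant_centerSpan : Invariant G (centerSpan G : Set (Cn n)) := by
  rintro f hf _ ⟨x, hx, rfl⟩
  obtain ⟨c, -, -, hfz⟩ := N.exists_ratio hf
  refine (N.mem_centerSpan _).2 ?_
  have : f x - p = c • (x - p) + (f p - p) := by rw [hfz x]; abel
  rw [this]
  exact H.add_mem (H.smul_mem c ((N.mem_centerSpan x).1 hx)) (N.apply_sub_mem f hf)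

theorem invariant_outside : Invariant G (outside G) := by
  rintro f hf _ ⟨x, hx, rfl⟩ hfx
  have := N.invariant_centerSpan _ (G.inv_mem hf) ⟨f x, hfx, rfl⟩
  rw [show f⁻¹ (f x) = x from f.symm_apply_apply x] at this
  exact hx this

theorem add_mem_of_invariant {A : Set (Cn n)} (hA : IsClosed A) (hinv : Invariant G A)
    {x h : Cn n} (hx : x ∈ A) (hh : h ∈ H) : x + h ∈ A := by
  have hh' : h ∈ closure (translationVectors G : Set (Cn n)) := N.closure_eq ▸ hh
  refine hA.closure_subset (map_mem_closure (f := fun t => x + t) (by fun_prop) hh' ?_)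
  rintro t ⟨g, hg, hgt⟩
  have : g x = x + t := by simpa using hgt x
  change x + t ∈ A
  exact this ▸ hinv g hg ⟨x, hx, rfl⟩

/-- A closed invariant set is stable under the homotheties of center `p` whose ratios occur
in `G`, although these need not belong to `G`. -/
theorem homothety_mem {A : Set (Cn n)} (hA : IsClosed A) (hinv : Invariant G A)
    {f : Equiv.Perm (Cn n)} (hf : f ∈ G) {c : ℂ} {b x : Cn n} (hfc : HasForm f c b)
    (hx : x ∈ A) : p + c • (x - p) ∈ A := by
  have h := N.add_mem_of_invariant hA hinv (hinv f hf ⟨x, hx, rfl⟩)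
    (H.neg_mem (N.apply_sub_mem f hf))
  convert h using 1
  rw [hfc.apply_eq p x]; abel

/-- The limit `μ` of the ratios `c k` along `f k v → w` is non-zero as
`w ∉ E_G`, so that the inverses of the `f k` bring `w` back to `v` modulo `H`. -/
theorem mem_closure_orb_symm {v w : Cn n} (hv : v ∈ outside G) (hw : w ∈ outside G)
    (hvw : w ∈ closure (orb G v)) : v ∈ closure (orb G w) := by
  have hv' : v - p ∉ H := fun h => hv ((N.mem_centerSpan v).2 h)
  have hw' : w - p ∉ H := fun h => hw ((N.mem_centerSpan w).2 h)
  -- A functional vanishing on `H` reads off the ratios `c k`, which therefore converge.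
  obtain ⟨φ, hφv, hφH⟩ := Submodule.exists_le_ker_of_notMem hv'
  have hφc : Continuous φ := φ.continuous_of_finiteDimensional
  obtain ⟨x, hx, hlim⟩ := mem_closure_iff_seq_limit.1 hvw
  choose f hfx using hx
  choose c hc hform hfz using fun k => N.exists_ratio (f k).2
  have hxk (k) : x k - p = c k • (v - p) + ((f k : Equiv.Perm (Cn n)) p - p) := by
    rw [← hfx k]
    change (f k : Equiv.Perm (Cn n)) v - p = _
    rw [hfz k v]; abel
  have hφx (k) : c k = φ (x k - p) / φ (v - p) := by
    have h0 : φ ((f k : Equiv.Perm (Cn n)) p - p) = 0 := hφH (N.apply_sub_mem _ (f k).2)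
    rw [hxk k, map_add, h0, map_smul, smul_eq_mul, add_zero, mul_div_cancel_right₀ _ hφv]
  obtain ⟨μ, hμ⟩ : ∃ μ, μ = φ (w - p) / φ (v - p) := ⟨_, rfl⟩
  have hcμ : Tendsto c atTop (𝓝 μ) := by
    rw [show c = fun k => φ (x k - p) / φ (v - p) from funext hφx, hμ]
    exact ((hφc.tendsto _).comp (hlim.sub_const p)).div_const _
  have hrem : w - p - μ • (v - p) ∈ H := by
    have hcl : IsClosed (H : Set (Cn n)) := Submodule.closed_of_finiteDimensional _
    refine hcl.mem_of_tendsto ((hlim.sub_const p).sub (hcμ.smul_const (v - p)))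
      (Eventually.of_forall fun k => ?_)
    rw [hxk k, add_sub_cancel_left]
    exact N.apply_sub_mem _ (f k).2
  have hμ0 : μ ≠ 0 := by
    rintro rfl
    rw [zero_smul, sub_zero] at hrem
    exact hw' hrem
  have hA : IsClosed (closure (orb G w)) := isClosed_closure
  have hinv := Invariant.closure_orb N.homotheties w
  have hlim' : p + μ⁻¹ • (w - p) ∈ closure (orb G w) := by
    refine hA.mem_of_tendsto (((hcμ.inv₀ hμ0).smul_const (w - p)).const_add p)
      (Eventually.of_forall fun k => ?_)
    obtain ⟨b, hb⟩ := hform k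
    exact N.homothety_mem hA hinv (G.inv_mem (f k).2) (hb.inv (hc k))
      (subset_closure (MulAction.mem_orbit_self w))
  have h := N.add_mem_of_invariant hA hinv hlim' (H.neg_mem (H.smul_mem μ⁻¹ hrem))
  convert h using 1
  rw [smul_sub _ (w - p), inv_smul_smul₀ hμ0]; abel

theorem isMinimalOrbitIn {v : Cn n} (hv : v ∈ outside G) : IsMinimalOrbitIn G (outside G) v := by
  refine ⟨isOpen_outside, N.invariant_outside, ?_, ?_⟩
  · rintro _ ⟨g, rfl⟩
    exact N.invariant_outside g g.2 ⟨v, hv, rfl⟩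
  · rintro w ⟨hw, hwU⟩
    congr 1
    exact Set.Subset.antisymm
      (closure_orb_subset isClosed_closure (Invariant.closure_orb N.homotheties w)
        (N.mem_closure_orb_symm hv hwU hw))
      (closure_orb_subset isClosed_closure (Invariant.closure_orb N.homotheties v) hw)

/-- An element of `G` of ratio `d` with `‖d‖ < 1` contracts any point of `A` to `p` modulo `H`. -/
theorem centerSpan_subset
    (hrot : ((G : Set (Equiv.Perm (Cn n))) \ rotations n).Nonempty) {A : Set (Cn n)}
    (hne : A.Nonempty) (hA : IsClosed A) (hinv : Invariant G A) :
    (centerSpan G : Set (Cn n)) ⊆ A := by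
  obtain ⟨f, hf, hfr⟩ := hrot
  obtain ⟨v, hv⟩ := hne
  obtain ⟨c, hc, ⟨b, hfc⟩, -⟩ := N.exists_ratio hf
  have hnorm : ‖c‖ ≠ 1 := by
    intro h
    refine hfr ⟨c.arg, b, ?_⟩
    have := Complex.norm_mul_exp_arg_mul_I c
    rw [h, Complex.ofReal_one, one_mul] at this
    rwa [this]
  obtain ⟨d, g, a, hg, hgd, hd⟩ : ∃ (d : ℂ) (g : Equiv.Perm (Cn n)) (a : Cn n),
      g ∈ G ∧ HasForm g d a ∧ ‖d‖ < 1 := by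
    rcases hnorm.lt_or_gt with h | h
    · exact ⟨c, f, b, hf, hfc, h⟩
    · refine ⟨c⁻¹, f⁻¹, _, G.inv_mem hf, hfc.inv hc, ?_⟩
      rw [norm_inv]
      exact inv_lt_one_of_one_lt₀ h
  have hpow (k : ℕ) : p + d ^ k • (v - p) ∈ A := by
    induction k with
    | zero => simpa using hv
    | succ k ih =>
      have := N.homothety_mem hA hinv hg hgd ih
      rwa [add_sub_cancel_left, smul_smul, ← pow_succ'] at this
  have hp : p ∈ A := by
    have hlim : Tendsto (fun k : ℕ => p + d ^ k • (v - p)) atTop (𝓝 (p + (0 : ℂ) • (v - p))) :=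
      ((tendsto_pow_atTop_nhds_zero_of_norm_lt_one hd).smul_const _).const_add p
    rw [zero_smul, add_zero] at hlim
    exact hA.mem_of_tendsto hlim (Eventually.of_forall hpow)
  intro x hx
  have := N.add_mem_of_invariant hA hinv hp ((N.mem_centerSpan x).1 hx)
  rwa [add_sub_cancel] at this

theorem isMinimalSet_centerSpan
    (hrot : ((G : Set (Equiv.Perm (Cn n))) \ rotations n).Nonempty) :
    IsMinimalSet G (centerSpan G : Set (Cn n)) :=
  ⟨⟨p, (N.mem_centerSpan p).2 (by simp)⟩,
    AffineSubspace.closed_of_finiteDimensional _, N.invariant_centerSpan,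
    fun _ hne hA hinv hsub => hsub.antisymm (N.centerSpan_subset hrot hne hA hinv)⟩

end NormalForm

/-! ### Orbits outside the span of the centers are homeomorphic -/

/-- One of `φ`, `ψ`, `φ + ψ` works, if `φ v ≠ 0` and `ψ w ≠ 0`. -/
theorem exists_functional_ne_zero {E : Type*} [AddCommGroup E] [Module ℂ E] {H : Submodule ℂ E}
    {v w : E} (hv : v ∉ H) (hw : w ∉ H) :
    ∃ φ : E →ₗ[ℂ] ℂ, H ≤ LinearMap.ker φ ∧ φ v ≠ 0 ∧ φ w ≠ 0 := by
  obtain ⟨φ, hφv, hφ⟩ := Submodule.exists_le_ker_of_notMem hv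
  obtain ⟨ψ, hψw, hψ⟩ := Submodule.exists_le_ker_of_notMem hw
  by_cases h1 : φ w = 0
  · by_cases h2 : ψ v = 0
    · refine ⟨φ + ψ, fun x hx => ?_, by simpa [h2], by simpa [h1]⟩
      have e1 : φ x = 0 := hφ hx
      have e2 : ψ x = 0 := hψ hx
      simp [e1, e2]
    · exact ⟨ψ, hψ, h2, hψw⟩
  · exact ⟨φ, hφ, hφv, h1⟩

/-- For `v, w` outside `p + H` there is an affine homeomorphism that fixes `p + H` pointwise, maps
`v` to `w`, and is a dilation or a transvection along `w - v`. -/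
theorem exists_homeomorph {H : Submodule ℂ (Cn n)} {p v w : Cn n} (hv : v - p ∉ H)
    (hw : w - p ∉ H) : ∃ A : Cn n ≃ₜ Cn n, A v = w ∧
      ∀ (c : ℂ) (z h : Cn n), h ∈ H → A (p + c • (z - p) + h) = p + c • (A z - p) + h := by
  obtain ⟨φ, hφ, hφv, hφw⟩ := exists_functional_ne_zero hv hw
  have hφc : Continuous φ := φ.continuous_of_finiteDimensional
  have hd : φ (w - v) = φ (w - p) - φ (v - p) := by rw [← map_sub]; congr 1; abel
  refine ⟨⟨⟨fun z => z + (φ (z - p) / φ (v - p)) • (w - v),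
    fun z => z - (φ (z - p) / φ (w - p)) • (w - v), fun z => ?_, fun z => ?_⟩, ?_, ?_⟩, ?_, ?_⟩
  · have h1 : z + (φ (z - p) / φ (v - p)) • (w - v) - p
        = (z - p) + (φ (z - p) / φ (v - p)) • (w - v) := by abel
    have h2 : (φ (z - p) + φ (z - p) / φ (v - p) * (φ (w - p) - φ (v - p))) / φ (w - p)
        = φ (z - p) / φ (v - p) := by field_simp; ring
    simp only [h1, map_add φ, map_smul φ, hd, smul_eq_mul, h2, add_sub_cancel_right]
  · have h1 : z - (φ (z - p) / φ (w - p)) • (w - v) - p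
        = (z - p) - (φ (z - p) / φ (w - p)) • (w - v) := by abel
    have h2 : (φ (z - p) - φ (z - p) / φ (w - p) * (φ (w - p) - φ (v - p))) / φ (v - p)
        = φ (z - p) / φ (w - p) := by field_simp; ring
    simp only [h1, map_sub φ (z - p), map_smul φ, hd, smul_eq_mul, h2, sub_add_cancel]
  · change Continuous fun z => z + (φ (z - p) / φ (v - p)) • (w - v)
    fun_prop
  · change Continuous fun z => z - (φ (z - p) / φ (w - p)) • (w - v)
    fun_prop
  · change v + (φ (v - p) / φ (v - p)) • (w - v) = w
    rw [div_self hφv, one_smul, add_sub_cancel]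
  · intro c z h hh
    have h0 : φ h = 0 := hφ hh
    change p + c • (z - p) + h + (φ (p + c • (z - p) + h - p) / φ (v - p)) • (w - v)
      = p + c • (z + (φ (z - p) / φ (v - p)) • (w - v) - p) + h
    rw [show p + c • (z - p) + h - p = c • (z - p) + h by abel, map_add, h0, map_smul, smul_eq_mul]
    module

theorem NormalForm.nonempty_homeomorph {p : Cn n} {H : Submodule ℂ (Cn n)} (N : NormalForm G p H)
    {v w : Cn n} (hv : v ∈ outside G) (hw : w ∈ outside G) : Nonempty (orb G v ≃ₜ orb G w) := by
  obtain ⟨A, hAv, hA⟩ := exists_homeomorph (fun h => hv ((N.mem_centerSpan v).2 h))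
    (fun h => hw ((N.mem_centerSpan w).2 h))
  have hcomm (f) (hf : f ∈ G) (z) : A (f z) = f (A z) := by
    obtain ⟨c, -, -, hfz⟩ := N.exists_ratio hf
    rw [hfz z, hA _ _ _ (N.apply_sub_mem f hf), hfz (A z)]
  have himage : A '' orb G v = orb G w := by
    ext x
    constructor
    · rintro ⟨_, ⟨g, rfl⟩, rfl⟩
      have := hcomm g g.2 v
      rw [hAv] at this
      exact ⟨g, this.symm⟩
    · rintro ⟨g, rfl⟩
      have := hcomm g g.2 v
      rw [hAv] at this
      exact ⟨g • v, ⟨g, rfl⟩, this⟩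
  exact ⟨(A.image _).trans (Homeomorph.setCongr himage)⟩

/-! ### Groups of special rotations -/

theorem exp_pow_twelve {θ : ℝ} (hθ : θ ∈ angles₂ ∪ angles₃) :
    Complex.exp (θ * Complex.I) ^ 12 = 1 := by
  obtain ⟨k, hk⟩ : ∃ k : ℤ, 12 * θ = k * (2 * Real.pi) := by
    rcases hθ with (⟨k, rfl⟩ | ⟨k, rfl⟩) | ((⟨k, rfl⟩ | ⟨k, rfl⟩) | ⟨k, rfl⟩)
    · exact ⟨3 + 6 * k, by push_cast; ring⟩
    · exact ⟨6 * k, by push_cast; ring⟩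
    · exact ⟨2 + 6 * k, by push_cast; ring⟩
    · exact ⟨-2 + 6 * k, by push_cast; ring⟩
    · exact ⟨6 * k, by push_cast; ring⟩
  rw [← Complex.exp_nat_mul, Complex.exp_eq_one_iff]
  refine ⟨k, ?_⟩
  have : ((12 * θ : ℝ) : ℂ) = ((k * (2 * Real.pi) : ℝ) : ℂ) := by rw [hk]
  push_cast at this ⊢
  rw [← mul_assoc, this]; ring

/-- A subgroup of finite index of a rational vector space is everything, because the quotient is
both finite and divisible. -/
theorem addSubgroup_eq_top_of_cover {E : Type*} [AddCommGroup E] [Module ℂ E] {K : AddSubgroup E}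
    {S : Set E} (hS : S.Finite) (hcov : ∀ x, ∃ s ∈ S, x - s ∈ K) : K = ⊤ := by
  have : Finite S := hS
  have hsurj : Function.Surjective (fun s : S => (QuotientAddGroup.mk (s : E) : E ⧸ K)) := by
    intro q
    obtain ⟨x, rfl⟩ := QuotientAddGroup.mk_surjective q
    obtain ⟨s, hs, h⟩ := hcov x
    refine ⟨⟨s, hs⟩, QuotientAddGroup.eq.2 ?_⟩
    rwa [neg_add_eq_sub]
  have : Finite (E ⧸ K) := Finite.of_surjective _ hsurj
  have hK : K.FiniteIndex := AddSubgroup.finiteIndex_of_finite_quotient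
  rw [eq_top_iff]
  intro x _
  have h := K.nsmul_index_mem ((K.index : ℂ)⁻¹ • x)
  rwa [← Nat.cast_smul_eq_nsmul ℂ, smul_inv_smul₀ (by exact_mod_cast hK.index_ne_zero)] at h

/-- One element `F c ∈ G` for each of the finitely many ratios `c` suffices to cover the orbit of `v`
by the cosets `F c v + K` of the closure `K` of the translation vectors. -/
theorem dense_translations_of_dense_orb (hsp : (G : Set (Equiv.Perm (Cn n))) ⊆ specialRotations n)
    {v : Cn n} (hv : closure (orb G v) = Set.univ) :
    closure (translationVectors G : Set (Cn n)) = Set.univ := by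
  set K := (translationVectors G).topologicalClosure
  have hK : IsClosed (K : Set (Cn n)) := AddSubgroup.isClosed_topologicalClosure _
  let Λ : Set ℂ := {c | c ^ 12 = 1 ∧ ∃ f ∈ G, ∃ b, HasForm f c b}
  have hΛ : Λ.Finite := by
    refine Set.Finite.subset (Polynomial.nthRootsFinset 12 (1 : ℂ)).finite_toSet fun c hc => ?_
    simpa [Polynomial.mem_nthRootsFinset] using hc.1
  choose! F hFG hF using fun (c : ℂ) (hc : c ∈ Λ) => hc.2
  have hcover : orb G v ⊆ ⋃ c ∈ Λ, (fun x => x - F c v) ⁻¹' (K : Set (Cn n)) := by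
    rintro _ ⟨⟨f, hf⟩, rfl⟩
    obtain ⟨θ, b, hθ, hfb⟩ : ∃ (θ : ℝ) (b : Cn n), θ ∈ angles₂ ∪ angles₃ ∧
        HasForm f (Complex.exp (θ * Complex.I)) b := by
      rcases hsp hf with ⟨θ, b, hθ, h⟩ | ⟨θ, b, hθ, h⟩
      · exact ⟨θ, b, .inl hθ, h⟩
      · exact ⟨θ, b, .inr hθ, h⟩
    have hc : Complex.exp (θ * Complex.I) ∈ Λ := ⟨exp_pow_twelve hθ, f, hf, b, hfb⟩
    obtain ⟨a, ha⟩ := hF _ hc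
    exact Set.mem_biUnion hc (subset_closure
      (sub_mem_translationVectors hf (hFG _ hc) (Complex.exp_ne_zero _) hfb ha v))
  have hclosed : IsClosed (⋃ c ∈ Λ, (fun x => x - F c v) ⁻¹' (K : Set (Cn n))) :=
    hΛ.isClosed_biUnion fun c _ => hK.preimage (by fun_prop)
  have htop : K = ⊤ := by
    refine addSubgroup_eq_top_of_cover (hΛ.image fun c => F c v) fun x => ?_
    have hx : x ∈ ⋃ c ∈ Λ, (fun x => x - F c v) ⁻¹' (K : Set (Cn n)) :=
      hclosed.closure_subset_iff.2 hcover (hv ▸ Set.mem_univ x)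
    simp only [Set.mem_iUnion] at hx
    obtain ⟨c, hc, hx⟩ := hx
    exact ⟨_, ⟨c, hc, rfl⟩, hx⟩
  change (K : Set (Cn n)) = Set.univ
  rw [htop]; rfl

end Group

end AffineHomothety

open AffineHomothety
theorem corollary1p2 (n : ℕ) (G : Subgroup (Equiv.Perm (Cn n)))
    (hG : G ≤ homotheties n)
    (hnonab : ∃ f ∈ G, ∃ g ∈ G, f * g ≠ g * f)
    (hratio : (ratios G \ Set.range ((↑) : ℝ → ℂ)).Nonempty) :
    (((G : Set (Equiv.Perm (Cn n))) \ specialRotations n).Nonempty → (outside G).Nonempty →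
      (∀ v ∈ outside G, IsMinimalOrbitIn G (outside G) v) ∧
      (((G : Set (Equiv.Perm (Cn n))) \ rotations n).Nonempty →
        IsMinimalSet G (centerSpan G : Set (Cn n)) ∧
        ∀ v : Cn n, (centerSpan G : Set (Cn n)) ⊆ closure (orb G v)) ∧
      (∀ v ∈ outside G, ∀ w ∈ outside G, Nonempty (orb G v ≃ₜ orb G w))) ∧
    ((G : Set (Equiv.Perm (Cn n))) ⊆ specialRotations n →
      ((∃ v : Cn n, closure (orb G v) = Set.univ) ↔
        closure (orb (translationPart G) 0) = Set.univ)) := by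
  have := nontrivial_of_not_comm hnonab
  refine ⟨fun hsp _ => ?_, fun hsp => ⟨?_, fun h => ⟨0, ?_⟩⟩⟩
  · obtain ⟨p, H, N⟩ := exists_normalForm hG hratio hsp
    exact ⟨fun v hv => N.isMinimalOrbitIn hv,
      fun hrot => ⟨N.isMinimalSet_centerSpan hrot, fun v =>
        N.centerSpan_subset hrot ⟨v, subset_closure (MulAction.mem_orbit_self v)⟩
          isClosed_closure (Invariant.closure_orb hG v)⟩,
      fun v hv w hw => N.nonempty_homeomorph hv hw⟩
  · rintro ⟨v, hv⟩
    rw [orb_translationPart_zero]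
    exact dense_translations_of_dense_orb hsp hv
  · refine Set.eq_univ_of_univ_subset (h ▸ closure_mono ?_)
    rintro _ ⟨g, rfl⟩
    exact apply_mem_orb g.2.1 0
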